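/- Let $M$ be a (finite-dimensional, Hausdorff) smooth manifold without boundary, $TM\backslash 0$ its tangent bundle without the null section, $\pi:TM\backslash 0\to M$ the projection, and $\mathcal VTM=\ker d\pi$ the vertical tangent bundle over $TM\backslash 0$. For $w\in TM\backslash 0$ let $i_w:T_{\pi(w)}M\to\mathcal V_wTM$, $i_w(u)=\frac{d}{dt}\big|_{t=0}(w+tu)$, be the vertical lift; put $C(w)=i_w(w)$ and $\mathcal J(X)=i_w(d\pi(X))$ for $X\in T_w(TM\backslash 0)$. For a vector field $V$ on an open set $\mathcal O\subseteq M$ let $V^{\mathfrak v}(w)=i_w(V(\pi(w)))$ on $\pi^{-1}(\mathcal O)$. Let $S$ be a spray on $M$, i.e. a smooth vector field on $TM\backslash 0$ with $\mathcal J(S)=C$ and $[C,S]=S$. Let $\Gamma_S=-[S,\mathcal J]$ be its canonical connection, i.e. $\Gamma_S(X)=-[S,\mathcal J(X)]+\mathcal J[S,X]$; let $\mathcal HTM=\ker(\Gamma_S-\mathrm I)$ be its horizontal distribution, so that $T(TM\backslash 0)=\mathcal HTM\oplus\mathcal VTM$, let $\mathcal H$ be the projection onto $\mathcal HTM$ along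 $\mathcal VTM$, and for $u\in T_{\pi(w)}M$ let $u^{\mathfrak h}\in\mathcal H_wTM$ be the horizontal vector at $w$ with $d\pi(u^{\mathfrak h})=u$. Let $\nabla$ be a smooth linear connection on the vector bundle $\mathcal VTM\to TM\backslash 0$ which is a lift of $\Gamma_S$: $\nabla_XC=X$ for every vertical $X$, and $\ker(X\mapsto\nabla_XC)=\mathcal HTM$. Its torsion is $\mathrm T(X,Y)=\nabla_X\mathcal J(Y)-\nabla_Y\mathcal J(X)-\mathcal J[X,Y]$. Consider the conditions (T1) $\mathrm T(S,Y)=0$ for all smooth vector fields $Y$ on $TM\backslash 0$; (T2) $\mathrm T(\mathcal HX,\mathcal HY)=0$ for all smooth vector fields $X,Y$ on $TM\backslash 0$. Let $\mathcal O\subseteq M$ be open and let $W$ be a smooth vector field on $\mathcal O$ that vanishes nowhere. For smooth vector fields $U,V$ on $\mathcal O$ define the vector field $D^W_UV$ on $\mathcal O$ by $$(D^W_UV)(x)=i_{w}^{-1}\,\nabla_{u^{\mathfrak h}}V^{\mathfrak v},\qquad w=W(x),\ u=U(x),$$ where $u^{\mathfrak h}$ is the horizontal lift of $u$ at $w$.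 Then: 1. If (T1) holds, then $D^W_WV-D^W_VW=[W,V]$ for all smooth vector fields $V$ on $\mathcal O$. 2. If (T2) holds, then $D^W_UV-D^W_VU=[U,V]$ for all smooth vector fields $U,V$ on $\mathcal O$. -/

import Mathlib

open scoped Manifold ContDiff Topology
open Bundle

noncomputable section

namespace SprayGeometry

variable {E : Type*} [NormedAddCommGroup E] [NormedSpace ℝ E]
  {M : Type*} [TopologicalSpace M] [ChartedSpace E M]

/-! ### The slit tangent bundle

Objects living on `TM \ 0` are represented by functions on the total space `TM` whose values on the
null section are irrelevant: every condition is imposed on (subsets of) the open set `slit`. -/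

/-- The tangent bundle without the null section, `TM \ 0`, as an open subset of `TM`. -/
def slit (E : Type*) [NormedAddCommGroup E] [NormedSpace ℝ E]
    (M : Type*) [TopologicalSpace M] [ChartedSpace E M] : Set (TangentBundle 𝓘(ℝ, E) M) :=
  {w | w.2 ≠ 0}

variable (E M) in
/-- Vector fields on `M` (not necessarily smooth). -/
abbrev MField : Type _ := (x : M) → TangentSpace 𝓘(ℝ, E) x

variable [IsManifold 𝓘(ℝ, E) ∞ M]

variable (E M) in
/-- Vector fields on `TM` (not necessarily smooth). -/
abbrev TMField : Type _ :=
  (w : TangentBundle 𝓘(ℝ, E) M) → TangentSpace 𝓘(ℝ, E).tangent w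

/-- `V ∈ 𝔛(O)`: `V` is smooth on the open set `O ⊆ M`. -/
def SmoothFieldOn (V : MField E M) (O : Set M) : Prop :=
  ContMDiffOn 𝓘(ℝ, E) 𝓘(ℝ, E).tangent ∞
    (fun x => (⟨x, V x⟩ : TangentBundle 𝓘(ℝ, E) M)) O

/-- `X` is a smooth vector field on the open set `U ⊆ TM`. -/
def TMField.SmoothOn (X : TMField E M)
    (U : Set (TangentBundle 𝓘(ℝ, E) M)) : Prop :=
  ContMDiffOn 𝓘(ℝ, E).tangent 𝓘(ℝ, E).tangent.tangent ∞
    (fun w => (⟨w, X w⟩ : TangentBundle 𝓘(ℝ, E).tangent (TangentBundle 𝓘(ℝ, E) M))) U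

/-- The differential `dπ(w) : T_w TM → T_{π(w)} M` of the projection `π : TM → M`. -/
def dproj (w : TangentBundle 𝓘(ℝ, E) M) :
    TangentSpace 𝓘(ℝ, E).tangent w →L[ℝ] TangentSpace 𝓘(ℝ, E) w.1 :=
  mfderiv 𝓘(ℝ, E).tangent 𝓘(ℝ, E) (fun v : TangentBundle 𝓘(ℝ, E) M => v.1) w

/-- A tangent vector of `TM` is vertical if it lies in the kernel of `dπ(w)`. -/
def IsVertical (w : TangentBundle 𝓘(ℝ, E) M) (X : TangentSpace 𝓘(ℝ, E).tangent w) : Prop :=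
  dproj w X = 0

/-- The vertical lift `i_w(u) = (d/dt)|_{t=0} (w + t u)`, for `u ∈ T_{π(w)} M`. -/
def vlift (w : TangentBundle 𝓘(ℝ, E) M) (u : TangentSpace 𝓘(ℝ, E) w.1) :
    TangentSpace 𝓘(ℝ, E).tangent w :=
  mfderiv 𝓘(ℝ, ℝ) 𝓘(ℝ, E).tangent
    (fun t : ℝ => (⟨w.1, w.2 + t • u⟩ : TangentBundle 𝓘(ℝ, E) M)) 0 (1 : ℝ)

/-- The inverse of the isomorphism `i_w : T_{π(w)} M → 𝒱_w TM` (only used on vertical vectors). -/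
def vliftInv (w : TangentBundle 𝓘(ℝ, E) M) (X : TangentSpace 𝓘(ℝ, E).tangent w) :
    TangentSpace 𝓘(ℝ, E) w.1 :=
  Function.invFun (vlift w) X

/-- The vertical lift `Vᵛ(w) = i_w(V(π(w)))` of a vector field on `M`. -/
def fieldVlift (V : MField E M) : TMField E M := fun w => vlift w (V w.1)

/-- The canonical vector field `C(w) = i_w(w)`. -/
def canonicalField : TMField E M := fun w => vlift w w.2

/-- The almost-tangent structure `J(X) = i_w(dπ(X))`, for `X ∈ T_w TM`. -/
def almostTangent (w : TangentBundle 𝓘(ℝ, E) M) (X : TangentSpace 𝓘(ℝ, E).tangent w) :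
    TangentSpace 𝓘(ℝ, E).tangent w :=
  vlift w (dproj w X)

/-- The almost-tangent structure applied to a vector field. -/
def almostTangentField (X : TMField E M) : TMField E M := fun w => almostTangent w (X w)

/-- The Lie bracket of vector fields on `TM`. -/
def bracket (X Y : TMField E M) : TMField E M :=
  VectorField.mlieBracket 𝓘(ℝ, E).tangent X Y

/-! ### Sprays and their canonical connection -/

/-- A spray on `M`: a smooth vector field `S` on `TM \ 0` with `J(S) = C` and `[C, S] = S`. -/
structure IsSpray (S : TMField E M) : Prop where
  smooth : S.SmoothOn (slit E M)
  secondOrder : ∀ w ∈ slit E M, almostTangent w (S w) = canonicalField w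
  homogeneous : ∀ w ∈ slit E M, bracket canonicalField S w = S w

/-- The Lie derivative `[S, J]` of the tensor field `J` along `S`, on vector fields:
`[S, J](X) = [S, J(X)] - J([S, X])`. -/
def lieDerivAlmostTangent (S X : TMField E M) : TMField E M :=
  fun w => bracket S (almostTangentField X) w - almostTangent w (bracket S X w)

/-- The canonical connection `Γ_S = -[S, J]` at `w`. Since `[S, J]` is a tensor field, its value on
a tangent vector `X ∈ T_w TM` is computed with any smooth local vector field extending `X`;
`FiberBundle.extend` is Mathlib's choice of such a field. -/
def canonicalConnection (S : TMField E M)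
    (w : TangentBundle 𝓘(ℝ, E) M)
    (X : TangentSpace 𝓘(ℝ, E).tangent w) : TangentSpace 𝓘(ℝ, E).tangent w :=
  -lieDerivAlmostTangent S (FiberBundle.extend (E × E) X) w

/-- The horizontal vectors at `w`: `ℋ_w TM = ker(Γ_S - I)`. -/
def IsHorizontal (S : TMField E M) (w : TangentBundle 𝓘(ℝ, E) M)
    (X : TangentSpace 𝓘(ℝ, E).tangent w) : Prop :=
  canonicalConnection S w X = X

/-- The projection onto the horizontal distribution along the vertical one, which is
`(I + Γ_S) / 2` because `Γ_S` is the identity on horizontal and minus the identity on vertical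
vectors. -/
def horizontalPart (S X : TMField E M) : TMField E M :=
  fun w => (1 / 2 : ℝ) • (X w + canonicalConnection S w (X w))

open Classical in
/-- The horizontal lift of `u ∈ T_{π(w)} M` at `w`: the horizontal vector `X ∈ T_w TM` with
`dπ(X) = u`. -/
def hlift (S : TMField E M) (w : TangentBundle 𝓘(ℝ, E) M)
    (u : TangentSpace 𝓘(ℝ, E) w.1) : TangentSpace 𝓘(ℝ, E).tangent w :=
  Classical.epsilon fun X => IsHorizontal S w X ∧ dproj w X = u

/-! ### Linear connections on the vertical tangent bundle -/

variable (E M) in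
/-- A (smooth) linear connection on the vertical tangent bundle `𝒱TM → TM \ 0`, as a covariant
derivative of local sections, i.e. of vertical vector fields `Y` on open sets `U ⊆ TM \ 0`:
`toFun Y w X` is `∇_X Y` at `w` for `X ∈ T_w TM`. -/
structure VerticalConnection where
  toFun : TMField E M → (w : TangentBundle 𝓘(ℝ, E) M) →
    TangentSpace 𝓘(ℝ, E).tangent w →L[ℝ] TangentSpace 𝓘(ℝ, E).tangent w
  vertical : ∀ {U : Set (TangentBundle 𝓘(ℝ, E) M)} {Y : TMField E M},
    IsOpen U → U ⊆ slit E M → Y.SmoothOn U → (∀ w ∈ U, IsVertical w (Y w)) →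
    ∀ w ∈ U, ∀ X : TangentSpace 𝓘(ℝ, E).tangent w, IsVertical w (toFun Y w X)
  smooth : ∀ {U : Set (TangentBundle 𝓘(ℝ, E) M)} {X Y : TMField E M},
    IsOpen U → U ⊆ slit E M → X.SmoothOn U → Y.SmoothOn U → (∀ w ∈ U, IsVertical w (Y w)) →
    TMField.SmoothOn (fun w => toFun Y w (X w)) U
  add : ∀ {U : Set (TangentBundle 𝓘(ℝ, E) M)} {Y Z : TMField E M},
    IsOpen U → U ⊆ slit E M → Y.SmoothOn U → Z.SmoothOn U →
    (∀ w ∈ U, IsVertical w (Y w)) → (∀ w ∈ U, IsVertical w (Z w)) →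
    ∀ w ∈ U, ∀ X : TangentSpace 𝓘(ℝ, E).tangent w,
      toFun (fun v => Y v + Z v) w X = toFun Y w X + toFun Z w X
  leibniz : ∀ {U : Set (TangentBundle 𝓘(ℝ, E) M)} {f : TangentBundle 𝓘(ℝ, E) M → ℝ}
    {Y : TMField E M},
    IsOpen U → U ⊆ slit E M → ContMDiffOn 𝓘(ℝ, E).tangent 𝓘(ℝ, ℝ) ∞ f U → Y.SmoothOn U →
    (∀ w ∈ U, IsVertical w (Y w)) →
    ∀ w ∈ U, ∀ X : TangentSpace 𝓘(ℝ, E).tangent w,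
      toFun (fun v => f v • Y v) w X =
        f w • toFun Y w X + mvfderiv 𝓘(ℝ, E).tangent f w X • Y w

/-- `∇` projects onto (is a lift of) `Γ_S`: it is almost-projectable, `∇_X C = X` for vertical `X`,
and the kernel of `X ↦ ∇_X C` is the horizontal distribution of `Γ_S`. -/
structure VerticalConnection.IsLift (D : VerticalConnection E M) (S : TMField E M) : Prop where
  almostProjectable : ∀ w ∈ slit E M, ∀ X : TangentSpace 𝓘(ℝ, E).tangent w,
    IsVertical w X → D.toFun canonicalField w X = X
  ker_eq : ∀ w ∈ slit E M, ∀ X : TangentSpace 𝓘(ℝ, E).tangent w,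
    D.toFun canonicalField w X = 0 ↔ IsHorizontal S w X

/-- The torsion `T(X, Y) = ∇_X J(Y) - ∇_Y J(X) - J([X, Y])`. -/
def VerticalConnection.torsion (D : VerticalConnection E M) (X Y : TMField E M) : TMField E M :=
  fun w => D.toFun (almostTangentField Y) w (X w) - D.toFun (almostTangentField X) w (Y w) -
    almostTangent w (bracket X Y w)

/-- Condition (T1): `T(S, Y) = 0` for all `Y ∈ 𝔛(TM \ 0)`. -/
def VerticalConnection.T1 (D : VerticalConnection E M) (S : TMField E M) : Prop :=
  ∀ Y : TMField E M, Y.SmoothOn (slit E M) → ∀ w ∈ slit E M, D.torsion S Y w = 0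

/-- Condition (T2): `T(ℋX, ℋY) = 0` for all `X, Y ∈ 𝔛(TM \ 0)`. -/
def VerticalConnection.T2 (D : VerticalConnection E M) (S : TMField E M) : Prop :=
  ∀ X Y : TMField E M, X.SmoothOn (slit E M) → Y.SmoothOn (slit E M) →
    ∀ w ∈ slit E M, D.torsion (horizontalPart S X) (horizontalPart S Y) w = 0

/-! ### The associated family of affine connections -/

/-- `D^w_u V = i_w⁻¹ ∇_{uʰ} Vᵛ`, for `w ∈ TM \ 0` and `u ∈ T_{π(w)} M`. -/
def VerticalConnection.affine (D : VerticalConnection E M) (S : TMField E M)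
    (w : TangentBundle 𝓘(ℝ, E) M) (u : TangentSpace 𝓘(ℝ, E) w.1) (V : MField E M) :
    TangentSpace 𝓘(ℝ, E) w.1 :=
  vliftInv w (D.toFun (fieldVlift V) w (hlift S w u))

/-- `(D^W_U V)(x) = D^{W(x)}_{U(x)} V`, for vector fields `W` (nowhere null), `U`, `V`. -/
def VerticalConnection.affineField (D : VerticalConnection E M) (S : TMField E M)
    (W U V : MField E M) : MField E M :=
  fun x => D.affine S ⟨x, W x⟩ (U x) V

end SprayGeometry

end

/-! Work in the natural coordinates `(x, y)` of the preferred chart at a point `w` of `TM \ 0`.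
There `J(S) = C` says `S = (y, s(x, y))`, and expanding `-[S, J]` gives `Γ_S(a, b) = (a, ∂_y s · a -
b)`. So the horizontal lift of `u` is `(u, ½ ∂_y s · u)`, and `[C, S] = S` becomes `∂_y s · y = 2
s`, that is, `S` is the horizontal lift of `w` at each `w`.

Under (T1), let `V^h` be the field of horizontal lifts of `V`. Since `J(S) = C` and `∇C` kills
horizontal vectors, `T(S, V^h) = 0` reads `∇_S V^v = J[S, V^h]`. Taking coordinates at `w = W(x)`
yields `D^W_W V = dV(W) - ½ ∂_y s · V` (`chartD_affine_of_T1`). For the other term, `W^v - C`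
vanishes at `w`, so its covariant derivative there is its ordinary derivative, whatever the
connection. As `∇_{u^h} C = 0`, this gives `D^W_u W = dW(u) - ½ ∂_y s · u` (`chartD_affine_self`).
With `u = V(x)` the spray terms cancel and `dV(W) - dW(V) = [W, V]` remains.

Under (T2), `T(U^h, V^h) = 0` says `∇_{U^h} V^v - ∇_{V^h} U^v = J[U^h, V^h]`. The horizontal lifts
are `π`-related to `U` and `V`, so the right side is the vertical lift of `[U, V]`
(`affine_sub_affine_of_T2`).

Both conditions test fields smooth on all of `TM \ 0`, so local fields on `M` are first extended by
a bump function; locality of `∇` (`toFun_congr`) makes this harmless. -/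

noncomputable section

namespace SprayGeometry

/-! ### Vector fields and Lie brackets read in a preferred chart -/

section ChartRepresentative

variable {F : Type*} [NormedAddCommGroup F] [NormedSpace ℝ F] {H : Type*} [TopologicalSpace H]
  {I : ModelWithCorners ℝ F H} {N : Type*} [TopologicalSpace N] [ChartedSpace H N]

/-- The differential at `x` of the preferred chart at `c`, with values in the model space. -/
def chartD (c x : N) : TangentSpace I x →L[ℝ] F :=
  mfderiv I 𝓘(ℝ, F) (extChartAt I c) x

/-- The representative of a vector field `X` on a manifold in the preferred chart at `c`. -/
def chartRep (c : N) (X : (x : N) → TangentSpace I x) (z : F) : F :=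
  chartD c ((extChartAt I c).symm z) (X ((extChartAt I c).symm z))

theorem chartRep_extChartAt {c x : N} (X : (x : N) → TangentSpace I x)
    (hx : x ∈ (extChartAt I c).source) :
    chartRep c X (extChartAt I c x) = chartD c x (X x) := by
  rw [chartRep, (extChartAt I c).left_inv hx]

variable [IsManifold I 1 N]

theorem chartD_self (c : N) (v : TangentSpace I c) : chartD c c v = v :=
  DFunLike.congr_fun (mfderiv_extChartAt_self (I := I) (x := c)) v

theorem trivializationAt_snd_eq_chartD {c x : N} (hx : x ∈ (chartAt H c).source)
    (v : TangentSpace I x) :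
    (trivializationAt F (TangentSpace I) c ⟨x, v⟩).2 = chartD c x v := by
  have h : (trivializationAt F (TangentSpace I) c).continuousLinearMapAt ℝ x v = chartD c x v :=
    DFunLike.congr_fun (TangentBundle.continuousLinearMapAt_trivializationAt hx) v
  rw [← h, Trivialization.continuousLinearMapAt_apply, Trivialization.coe_linearMapAt_of_mem]
  exact hx

theorem chartD_bijective {c x : N} (hx : x ∈ (extChartAt I c).source) :
    Function.Bijective (chartD c x : TangentSpace I x → F) :=
  (isInvertible_mfderiv_extChartAt hx).bijective

theorem chartRep_eq_mpullbackWithin (c : N) (X : (x : N) → TangentSpace I x) {z : F}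
    (hz : z ∈ (extChartAt I c).target) :
    VectorField.mpullbackWithin 𝓘(ℝ, F) I (extChartAt I c).symm X (Set.range I) z
      = chartRep c X z := by
  rw [VectorField.mpullbackWithin_apply, ContinuousLinearMap.inverse_eq
    (mfderivWithin_extChartAt_symm_comp_mfderiv_extChartAt hz)
    (mfderiv_extChartAt_comp_mfderivWithin_extChartAt_symm hz)]
  rfl

/-- The bracket is computed in the chart centred at `c` and pulled back by the derivative of that
chart at `c`, which is the identity; hence no correction factor. -/
theorem mlieBracket_eq_lieBracket_chartRep [I.Boundaryless] (c : N)
    (X Y : (x : N) → TangentSpace I x) :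
    VectorField.mlieBracket I X Y c =
      VectorField.lieBracket ℝ (chartRep c X) (chartRep c Y) (extChartAt I c c) := by
  have key : ∀ Z : (x : N) → TangentSpace I x,
      VectorField.mpullbackWithin 𝓘(ℝ, F) I (extChartAt I c).symm Z (Set.range I)
        =ᶠ[𝓝 (extChartAt I c c)] chartRep c Z := fun Z => by
    filter_upwards [extChartAt_target_mem_nhds (I := I) c] with z hz
    exact chartRep_eq_mpullbackWithin c Z hz
  have hinv : ∀ v : F, (mfderiv I 𝓘(ℝ, F) (extChartAt I c) c).inverse v = v := fun v =>
    (isInvertible_mfderiv_extChartAt (mem_extChartAt_source (I := I) c)).injective <|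
      ((isInvertible_mfderiv_extChartAt (mem_extChartAt_source (I := I) c)).self_apply_inverse
        v).trans (chartD_self c v).symm
  rw [← VectorField.mlieBracketWithin_univ, VectorField.mlieBracketWithin_apply, hinv,
    Set.preimage_univ, Set.univ_inter]
  have huniv : ∀ (A B : F → F) (s : Set F) (z : F), s = Set.univ →
      VectorField.lieBracketWithin ℝ A B s z = VectorField.lieBracket ℝ A B z := by
    rintro A B _ z rfl
    rw [VectorField.lieBracketWithin_univ]
  exact (huniv _ _ _ _ I.range_eq_univ).trans ((key X).lieBracket_vectorField_eq (key Y))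

/-- The point `x` ranges over the whole chart domain of `c`: frame coefficients taken in one fixed
chart must be smooth on a neighbourhood, not only at its centre. -/
theorem contMDiffAt_iff_chartRep [I.Boundaryless] [IsManifold I ∞ N] {c x : N}
    (hx : x ∈ (chartAt H c).source) (X : (x : N) → TangentSpace I x) :
    ContMDiffAt I I.tangent ∞ (fun y => (⟨y, X y⟩ : TangentBundle I N)) x ↔
      ContDiffAt ℝ ∞ (chartRep c X) (extChartAt I c x) := by
  have : IsManifold I (∞ + 1) N := inferInstanceAs (IsManifold I ∞ N)
  have hx' : x ∈ (extChartAt I c).source := by rwa [extChartAt_source]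
  have h0 := (trivializationAt F (TangentSpace I) c).contMDiffAt_section_iff (IB := I) (n := ∞)
    (s := X) (x₀ := x) hx
  have h1 : (fun y => (trivializationAt F (TangentSpace I) c ⟨y, X y⟩).2)
      =ᶠ[𝓝 x] chartRep c X ∘ extChartAt I c := by
    filter_upwards [(chartAt H c).open_source.mem_nhds hx] with y hy
    rw [Function.comp_apply, chartRep_extChartAt X (by rwa [extChartAt_source]),
      trivializationAt_snd_eq_chartD hy]
  rw [Filter.EventuallyEq.contMDiffAt_iff h1] at h0
  refine h0.trans ?_
  rw [← contMDiffAt_iff_contDiffAt]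
  have htarget := extChartAt_target_mem_nhds' (I := I) ((extChartAt I c).map_source hx')
  constructor
  · intro h
    have h2 : ContMDiffAt 𝓘(ℝ, F) I ∞ (extChartAt I c).symm (extChartAt I c x) :=
      (contMDiffOn_extChartAt_symm c).contMDiffAt htarget
    have h3 := ContMDiffAt.comp (extChartAt I c x) (by rwa [(extChartAt I c).left_inv hx']) h2
    refine h3.congr_of_eventuallyEq ?_
    filter_upwards [htarget] with z hz
    rw [Function.comp_apply, Function.comp_apply, (extChartAt I c).right_inv hz]
  · intro h
    exact h.comp x (contMDiffAt_extChartAt' hx)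

omit [IsManifold I 1 N] in
theorem chartRep_congr {c : N} {X Y : (x : N) → TangentSpace I x} (h : ∀ᶠ x in 𝓝 c, X x = Y x) :
    chartRep c X =ᶠ[𝓝 (extChartAt I c c)] chartRep c Y := by
  have := (continuousAt_extChartAt_symm (I := I) c).eventually
    (by rwa [extChartAt_to_inv])
  filter_upwards [this] with z hz
  rw [chartRep, chartRep, hz]

end ChartRepresentative

/-! ### Natural coordinates on `TM`: projection, vertical lift, `J` and `C` -/

section TangentCoordinates

variable {E : Type*} [NormedAddCommGroup E] [NormedSpace ℝ E]
  {M : Type*} [TopologicalSpace M] [ChartedSpace E M] [IsManifold 𝓘(ℝ, E) ∞ M]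

theorem extChartAt_tangentBundle_apply (w₀ w : TangentBundle 𝓘(ℝ, E) M)
    (hw : w.1 ∈ (chartAt E w₀.1).source) :
    extChartAt 𝓘(ℝ, E).tangent w₀ w = (extChartAt 𝓘(ℝ, E) w₀.1 w.1, chartD w₀.1 w.1 w.2) := by
  rw [← trivializationAt_snd_eq_chartD hw]
  rfl

theorem mem_extChartAt_tangentBundle_source {w₀ w : TangentBundle 𝓘(ℝ, E) M} :
    w ∈ (extChartAt 𝓘(ℝ, E).tangent w₀).source ↔ w.1 ∈ (chartAt E w₀.1).source := by
  rw [extChartAt_source]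
  exact TangentBundle.mem_chart_source_iff w w₀

/-- Differentiate the identity "first component of the chart of `TM` = chart of `M` after `π`" in
two ways. -/
theorem chartD_fst {w₀ w : TangentBundle 𝓘(ℝ, E) M} (hw : w.1 ∈ (chartAt E w₀.1).source)
    (X : TangentSpace 𝓘(ℝ, E).tangent w) :
    (chartD w₀ w X : E × E).1 = chartD w₀.1 w.1 (dproj w X) := by
  have hφ := (mdifferentiableAt_extChartAt (I := 𝓘(ℝ, E)) hw).hasMFDerivAt
  have hπ := ((contMDiff_proj (TangentSpace 𝓘(ℝ, E) : M → Type _) (IB := 𝓘(ℝ, E))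
    (n := 1)).mdifferentiableAt one_ne_zero (x := w)).hasMFDerivAt
  have hΦ := (mdifferentiableAt_extChartAt (I := 𝓘(ℝ, E).tangent) (x := w₀)
    ((TangentBundle.mem_chart_source_iff w w₀).2 hw)).hasMFDerivAt
  have h1 := hφ.comp w hπ
  have h2 := (hasMFDerivAt_iff_hasFDerivAt.2
    (hasFDerivAt_fst (𝕜 := ℝ) (p := extChartAt 𝓘(ℝ, E).tangent w₀ w))).comp w hΦ
  exact DFunLike.congr_fun (hasMFDerivAt_unique h2 h1) X

/-- The vector `X` and the equation `hX` are separate because `X` sits over `x`, while the velocity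
sits over `γ 0`. For the vertical lift these base points agree only after simplifying `0 • u`. -/
theorem chartD_mfderiv_curve {F : Type*} [NormedAddCommGroup F] [NormedSpace ℝ F] {H : Type*}
    [TopologicalSpace H] {I : ModelWithCorners ℝ F H} {N : Type*} [TopologicalSpace N]
    [ChartedSpace H N] [IsManifold I 1 N] {γ : ℝ → N} (hγ : MDifferentiableAt 𝓘(ℝ, ℝ) I γ 0)
    {c x : N} (hx : x ∈ (chartAt H c).source) (h0 : γ 0 = x) {v : F}
    (hv : HasDerivAt (fun t => extChartAt I c (γ t)) v 0) (X : TangentSpace I x)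
    (hX : X = mfderiv 𝓘(ℝ, ℝ) I γ 0 (1 : ℝ)) :
    chartD c x X = v := by
  subst h0
  have h1 := (mdifferentiableAt_extChartAt (I := I) hx).hasMFDerivAt.comp (0 : ℝ) hγ.hasMFDerivAt
  have h2 := DFunLike.congr_fun (hasMFDerivAt_unique h1
    (hasMFDerivAt_iff_hasFDerivAt.2 hv.hasFDerivAt)) (1 : ℝ)
  subst hX
  exact h2.trans (one_smul ℝ v)

/-- Trivializations are linear on fibres, so the curve `w + t u` is affine in coordinates and its
velocity can be read off. -/
theorem chartD_vlift {w₀ w : TangentBundle 𝓘(ℝ, E) M} (hw : w.1 ∈ (chartAt E w₀.1).source)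
    (u : TangentSpace 𝓘(ℝ, E) w.1) :
    (chartD w₀ w (vlift w u) : E × E) = (0, chartD w₀.1 w.1 u) := by
  have hlin : ∀ (c : M), w.1 ∈ (chartAt E c).source → ∀ t : ℝ,
      (trivializationAt E (TangentSpace 𝓘(ℝ, E)) c
        (⟨w.1, w.2 + t • u⟩ : TangentBundle 𝓘(ℝ, E) M)).2
        = chartD c w.1 w.2 + t • chartD c w.1 u := fun c hc t => by
    rw [trivializationAt_snd_eq_chartD hc, map_add, map_smul]
  refine chartD_mfderiv_curve
    (γ := fun t : ℝ => (⟨w.1, w.2 + t • u⟩ : TangentBundle 𝓘(ℝ, E) M)) ?_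
    ((TangentBundle.mem_chart_source_iff w w₀).2 hw) ?_ ?_ _ rfl
  · refine ContMDiffAt.mdifferentiableAt (n := 1) ?_ one_ne_zero
    rw [Bundle.contMDiffAt_totalSpace]
    refine ⟨contMDiffAt_const, ?_⟩
    have : ContDiff ℝ 1 fun t : ℝ => chartD w.1 w.1 w.2 + t • chartD w.1 w.1 u := by fun_prop
    refine this.contMDiff.contMDiffAt.congr_of_eventuallyEq (Filter.Eventually.of_forall ?_)
    exact hlin w.1 (mem_chart_source E w.1)
  · simp
  · have h1 : HasDerivAt (fun t : ℝ => chartD w₀.1 w.1 w.2 + t • chartD w₀.1 w.1 u)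
        (chartD w₀.1 w.1 u) 0 := by
      simpa using ((hasDerivAt_id (0 : ℝ)).smul_const (chartD w₀.1 w.1 u)).const_add
        (chartD w₀.1 w.1 w.2)
    refine ((hasDerivAt_const (0 : ℝ) (extChartAt 𝓘(ℝ, E) w₀.1 w.1)).prodMk h1).congr_of_eventuallyEq
      (Filter.Eventually.of_forall fun t => ?_)
    exact Prod.ext rfl (hlin w₀.1 hw t)

theorem vlift_injective (w : TangentBundle 𝓘(ℝ, E) M) : Function.Injective (vlift w) := by
  intro u v h
  have := congrArg (chartD w w) h
  rw [chartD_vlift (mem_chart_source E w.1), chartD_vlift (mem_chart_source E w.1)] at this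
  exact (chartD_bijective (mem_extChartAt_source w.1)).injective (congrArg Prod.snd this)

theorem vliftInv_vlift (w : TangentBundle 𝓘(ℝ, E) M) (u : TangentSpace 𝓘(ℝ, E) w.1) :
    vliftInv w (vlift w u) = u :=
  Function.leftInverse_invFun (vlift_injective w) u

theorem chartD_self_injective {F : Type*} [NormedAddCommGroup F] [NormedSpace ℝ F] {H : Type*}
    [TopologicalSpace H] {I : ModelWithCorners ℝ F H} {N : Type*} [TopologicalSpace N]
    [ChartedSpace H N] [IsManifold I 1 N] (x : N) :
    Function.Injective (chartD x x : TangentSpace I x → F) :=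
  (chartD_bijective (mem_extChartAt_source x)).injective

theorem chartD_self_vlift (w : TangentBundle 𝓘(ℝ, E) M) (u : TangentSpace 𝓘(ℝ, E) w.1) :
    chartD w w (vlift w u) = ((0 : E), chartD w.1 w.1 u) :=
  chartD_vlift (mem_chart_source E w.1) u

theorem chartD_dproj (w : TangentBundle 𝓘(ℝ, E) M) (X : TangentSpace 𝓘(ℝ, E).tangent w) :
    chartD w.1 w.1 (dproj w X) = (chartD w w X).1 :=
  (chartD_fst (mem_chart_source E w.1) X).symm

theorem chartD_almostTangent (w : TangentBundle 𝓘(ℝ, E) M)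
    (X : TangentSpace 𝓘(ℝ, E).tangent w) :
    chartD w w (almostTangent w X) = ((0 : E), (chartD w w X).1) := by
  rw [almostTangent, chartD_self_vlift, chartD_dproj]

theorem chartRep_almostTangentField (w₀ : TangentBundle 𝓘(ℝ, E) M) (X : TMField E M) :
    chartRep w₀ (almostTangentField X) =ᶠ[𝓝 (extChartAt 𝓘(ℝ, E).tangent w₀ w₀)]
      fun z => ((0 : E), (chartRep w₀ X z).1) := by
  filter_upwards [extChartAt_target_mem_nhds (I := 𝓘(ℝ, E).tangent) w₀] with z hz
  have hw := mem_extChartAt_tangentBundle_source.1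
    ((extChartAt 𝓘(ℝ, E).tangent w₀).map_target hz)
  rw [chartRep, almostTangentField, almostTangent, chartD_vlift hw, ← chartD_fst hw]
  rfl

theorem chartRep_fieldVlift (w₀ : TangentBundle 𝓘(ℝ, E) M) (V : MField E M) :
    chartRep w₀ (fieldVlift V) =ᶠ[𝓝 (extChartAt 𝓘(ℝ, E).tangent w₀ w₀)]
      fun z => ((0 : E), chartRep w₀.1 V z.1) := by
  filter_upwards [extChartAt_target_mem_nhds (I := 𝓘(ℝ, E).tangent) w₀] with z hz
  have hw := mem_extChartAt_tangentBundle_source.1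
    ((extChartAt 𝓘(ℝ, E).tangent w₀).map_target hz)
  rw [chartRep, fieldVlift, chartD_vlift hw]
  rfl

theorem chartD_symm_snd {w₀ : TangentBundle 𝓘(ℝ, E) M} {z : E × E}
    (hz : z ∈ (extChartAt 𝓘(ℝ, E).tangent w₀).target) :
    chartD w₀.1 ((extChartAt 𝓘(ℝ, E).tangent w₀).symm z).1
      ((extChartAt 𝓘(ℝ, E).tangent w₀).symm z).2 = z.2 := by
  have hw := mem_extChartAt_tangentBundle_source.1
    ((extChartAt 𝓘(ℝ, E).tangent w₀).map_target hz)
  have := (extChartAt 𝓘(ℝ, E).tangent w₀).right_inv hz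
  rw [extChartAt_tangentBundle_apply _ _ hw] at this
  exact congrArg Prod.snd this

theorem chartRep_canonicalField (w₀ : TangentBundle 𝓘(ℝ, E) M) :
    chartRep w₀ canonicalField =ᶠ[𝓝 (extChartAt 𝓘(ℝ, E).tangent w₀ w₀)]
      fun z : E × E => ((0 : E), z.2) := by
  filter_upwards [extChartAt_target_mem_nhds (I := 𝓘(ℝ, E).tangent) w₀] with z hz
  have hw := mem_extChartAt_tangentBundle_source.1
    ((extChartAt 𝓘(ℝ, E).tangent w₀).map_target hz)
  rw [chartRep, canonicalField, chartD_vlift hw, chartD_symm_snd hz]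

end TangentCoordinates

/-! ### Smoothness and first derivatives of fields on `TM` -/

section SmoothFields

variable {E : Type*} [NormedAddCommGroup E] [NormedSpace ℝ E]
  {M : Type*} [TopologicalSpace M] [ChartedSpace E M] [IsManifold 𝓘(ℝ, E) ∞ M]

theorem isOpen_slit : IsOpen (slit E M) := by
  rw [isOpen_iff_mem_nhds]
  intro w₀ hw₀
  have h0 : (extChartAt 𝓘(ℝ, E).tangent w₀ w₀).2 ≠ 0 := by
    rw [extChartAt_tangentBundle_apply w₀ w₀ (mem_chart_source E w₀.1)]
    change chartD w₀.1 w₀.1 w₀.2 ≠ 0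
    rwa [chartD_self]
  have hc : ContinuousAt (fun w => (extChartAt 𝓘(ℝ, E).tangent w₀ w).2) w₀ :=
    continuousAt_snd.comp (continuousAt_extChartAt (I := 𝓘(ℝ, E).tangent) w₀)
  filter_upwards [hc.eventually_ne h0,
    extChartAt_source_mem_nhds (I := 𝓘(ℝ, E).tangent) w₀] with w hw hsrc h
  rw [extChartAt_tangentBundle_apply w₀ w (mem_extChartAt_tangentBundle_source.1 hsrc), h] at hw
  exact hw (map_zero _)

/-- Smoothness of a vector field on an open subset of `TM`, in terms of representatives. -/
theorem TMField.smoothOn_iff {X : TMField E M} {U : Set (TangentBundle 𝓘(ℝ, E) M)}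
    (hU : IsOpen U) :
    X.SmoothOn U ↔
      ∀ w ∈ U, ContDiffAt ℝ ∞ (chartRep w X) (extChartAt 𝓘(ℝ, E).tangent w w) :=
  ⟨fun h w hw => (contMDiffAt_iff_chartRep (mem_chart_source _ w) X).1
      ((h w hw).contMDiffAt (hU.mem_nhds hw)),
    fun h w hw => ((contMDiffAt_iff_chartRep (mem_chart_source _ w) X).2
      (h w hw)).contMDiffWithinAt⟩

theorem TMField.SmoothOn.congr {X Y : TMField E M} {U : Set (TangentBundle 𝓘(ℝ, E) M)}
    (hX : X.SmoothOn U) (h : ∀ w ∈ U, Y w = X w) : Y.SmoothOn U :=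
  ContMDiffOn.congr hX fun w hw => by rw [h w hw]

theorem smoothOn_canonicalField {U : Set (TangentBundle 𝓘(ℝ, E) M)} (hU : IsOpen U) :
    (canonicalField : TMField E M).SmoothOn U := by
  rw [TMField.smoothOn_iff hU]
  intro w _
  refine ContDiffAt.congr_of_eventuallyEq ?_ (chartRep_canonicalField w)
  fun_prop

theorem smoothOn_almostTangentField {X : TMField E M} {U : Set (TangentBundle 𝓘(ℝ, E) M)}
    (hU : IsOpen U) (hX : X.SmoothOn U) : (almostTangentField X).SmoothOn U := by
  rw [TMField.smoothOn_iff hU] at hX ⊢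
  intro w hw
  exact (contDiffAt_const.prodMk (hX w hw).fst).congr_of_eventuallyEq
    (chartRep_almostTangentField w X)

theorem SmoothFieldOn.contDiffAt_chartRep {V : MField E M} {O : Set M} (hO : IsOpen O)
    (hV : SmoothFieldOn V O) {x : M} (hx : x ∈ O) :
    ContDiffAt ℝ ∞ (chartRep x V) (extChartAt 𝓘(ℝ, E) x x) :=
  (contMDiffAt_iff_chartRep (mem_chart_source E x) V).1 ((hV x hx).contMDiffAt (hO.mem_nhds hx))

theorem smoothOn_fieldVlift {V : MField E M} {O : Set M} (hO : IsOpen O)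
    (hV : SmoothFieldOn V O) {U : Set (TangentBundle 𝓘(ℝ, E) M)} (hU : IsOpen U)
    (hUO : ∀ w ∈ U, w.1 ∈ O) : (fieldVlift V).SmoothOn U := by
  rw [TMField.smoothOn_iff hU]
  intro w hw
  have h := hV.contDiffAt_chartRep hO (hUO w hw)
  exact (contDiffAt_const.prodMk (ContDiffAt.comp (f := Prod.fst)
    (extChartAt 𝓘(ℝ, E).tangent w w) h contDiffAt_fst)).congr_of_eventuallyEq
    (chartRep_fieldVlift w V)

theorem smoothOn_bracket [CompleteSpace E] {X Y : TMField E M}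
    {U : Set (TangentBundle 𝓘(ℝ, E) M)}
    (hU : IsOpen U) (hX : X.SmoothOn U) (hY : Y.SmoothOn U) : (bracket X Y).SmoothOn U := by
  intro w hw
  have : IsManifold 𝓘(ℝ, E).tangent (((⊤ : ℕ∞) : ℕ∞ω) + 1) (TangentBundle 𝓘(ℝ, E) M) :=
    inferInstanceAs (IsManifold 𝓘(ℝ, E).tangent ∞ (TangentBundle 𝓘(ℝ, E) M))
  have : IsManifold 𝓘(ℝ, E).tangent (minSmoothness ℝ 2) (TangentBundle 𝓘(ℝ, E) M) := by
    rw [minSmoothness_of_isRCLikeNormedField]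
    exact IsManifold.of_le (n := ∞) (WithTop.coe_le_coe.2 (le_top : (2 : ℕ∞) ≤ ⊤))
  refine ContMDiffAt.contMDiffWithinAt ?_
  exact ContMDiffAt.mlieBracket_vectorField (m := ⊤) (n := ⊤)
    ((hX w hw).contMDiffAt (hU.mem_nhds hw)) ((hY w hw).contMDiffAt (hU.mem_nhds hw)) (by simp)

theorem TMField.SmoothOn.add {X Y : TMField E M} {U : Set (TangentBundle 𝓘(ℝ, E) M)}
    (hX : X.SmoothOn U) (hY : Y.SmoothOn U) : TMField.SmoothOn (fun w => X w + Y w) U :=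
  ContMDiffOn.add_section hX hY

theorem TMField.SmoothOn.sub {X Y : TMField E M} {U : Set (TangentBundle 𝓘(ℝ, E) M)}
    (hX : X.SmoothOn U) (hY : Y.SmoothOn U) : TMField.SmoothOn (fun w => X w - Y w) U :=
  ContMDiffOn.sub_section hX hY

theorem TMField.SmoothOn.smul {f : TangentBundle 𝓘(ℝ, E) M → ℝ} {X : TMField E M}
    {U : Set (TangentBundle 𝓘(ℝ, E) M)} (hf : ContMDiffOn 𝓘(ℝ, E).tangent 𝓘(ℝ, ℝ) ∞ f U)
    (hX : X.SmoothOn U) : TMField.SmoothOn (fun w => f w • X w) U :=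
  ContMDiffOn.smul_section hf hX

theorem TMField.SmoothOn.sum {ι : Type*} {s : Finset ι} {X : ι → TMField E M}
    {U : Set (TangentBundle 𝓘(ℝ, E) M)} (hX : ∀ i ∈ s, (X i).SmoothOn U) :
    TMField.SmoothOn (fun w => ∑ i ∈ s, X i w) U :=
  ContMDiffOn.sum_section hX

theorem chartD_mlieBracket {F : Type*} [NormedAddCommGroup F] [NormedSpace ℝ F] {H : Type*}
    [TopologicalSpace H] {I : ModelWithCorners ℝ F H} [I.Boundaryless] {N : Type*}
    [TopologicalSpace N] [ChartedSpace H N] [IsManifold I 1 N] (X Y : (x : N) → TangentSpace I x)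
    (c : N) :
    chartD c c (VectorField.mlieBracket I X Y c) =
      fderiv ℝ (chartRep c Y) (extChartAt I c c) (chartD c c (X c)) -
        fderiv ℝ (chartRep c X) (extChartAt I c c) (chartD c c (Y c)) := by
  rw [chartD_self, mlieBracket_eq_lieBracket_chartRep, VectorField.lieBracket,
    chartRep_extChartAt X (mem_extChartAt_source c),
    chartRep_extChartAt Y (mem_extChartAt_source c)]

theorem chartD_bracket (X Y : TMField E M) (w : TangentBundle 𝓘(ℝ, E) M) :
    chartD w w (bracket X Y w) =
      fderiv ℝ (chartRep w Y) (extChartAt 𝓘(ℝ, E).tangent w w) (chartD w w (X w)) -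
        fderiv ℝ (chartRep w X) (extChartAt 𝓘(ℝ, E).tangent w w) (chartD w w (Y w)) :=
  chartD_mlieBracket X Y w

theorem fderiv_chartRep_almostTangentField {X : TMField E M} {w : TangentBundle 𝓘(ℝ, E) M}
    (hX : DifferentiableAt ℝ (chartRep w X) (extChartAt 𝓘(ℝ, E).tangent w w)) (v : E × E) :
    fderiv ℝ (chartRep w (almostTangentField X)) (extChartAt 𝓘(ℝ, E).tangent w w) v =
      ((0 : E), (fderiv ℝ (chartRep w X) (extChartAt 𝓘(ℝ, E).tangent w w) v).1) := by
  rw [(chartRep_almostTangentField w X).fderiv_eq,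
    ((hasFDerivAt_const (0 : E) _).prodMk hX.hasFDerivAt.fst).fderiv]
  rfl

theorem fderiv_chartRep_fieldVlift {V : MField E M} {w : TangentBundle 𝓘(ℝ, E) M}
    (hV : DifferentiableAt ℝ (chartRep w.1 V) (extChartAt 𝓘(ℝ, E) w.1 w.1)) (v : E × E) :
    fderiv ℝ (chartRep w (fieldVlift V)) (extChartAt 𝓘(ℝ, E).tangent w w) v =
      ((0 : E), fderiv ℝ (chartRep w.1 V) (extChartAt 𝓘(ℝ, E) w.1 w.1) v.1) := by
  have h : HasFDerivAt (fun z : E × E => chartRep w.1 V z.1)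
      ((fderiv ℝ (chartRep w.1 V) (extChartAt 𝓘(ℝ, E) w.1 w.1)).comp
        (ContinuousLinearMap.fst ℝ E E)) (extChartAt 𝓘(ℝ, E).tangent w w) :=
    HasFDerivAt.comp (f := Prod.fst) (extChartAt 𝓘(ℝ, E).tangent w w) hV.hasFDerivAt hasFDerivAt_fst
  rw [(chartRep_fieldVlift w V).fderiv_eq, ((hasFDerivAt_const (0 : E) _).prodMk h).fderiv]
  rfl

theorem fderiv_chartRep_canonicalField (w : TangentBundle 𝓘(ℝ, E) M) (v : E × E) :
    fderiv ℝ (chartRep w canonicalField) (extChartAt 𝓘(ℝ, E).tangent w w) v = ((0 : E), v.2) := by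
  rw [(chartRep_canonicalField w).fderiv_eq,
    ((hasFDerivAt_const (0 : E) _).prodMk hasFDerivAt_snd).fderiv]
  rfl

/-- A field `X` on `TM` that is `π`-related near `w` to a field `V` on `M` has the representative
of `V` as first component. -/
theorem chartRep_fst_of_dproj_eq {X : TMField E M} {V : MField E M}
    {w₀ : TangentBundle 𝓘(ℝ, E) M} (h : ∀ᶠ w in 𝓝 w₀, dproj w (X w) = V w.1) :
    (fun z => (chartRep w₀ X z).1) =ᶠ[𝓝 (extChartAt 𝓘(ℝ, E).tangent w₀ w₀)]
      fun z => chartRep w₀.1 V z.1 := by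
  have h' := (continuousAt_extChartAt_symm (I := 𝓘(ℝ, E).tangent) w₀).eventually
    (by rwa [extChartAt_to_inv])
  filter_upwards [h', extChartAt_target_mem_nhds (I := 𝓘(ℝ, E).tangent) w₀] with z hz hzt
  have hw := mem_extChartAt_tangentBundle_source.1
    ((extChartAt 𝓘(ℝ, E).tangent w₀).map_target hzt)
  rw [chartRep, chartD_fst hw, hz]
  rfl

theorem fderiv_chartRep_fst_of_dproj_eq {X : TMField E M} {V : MField E M}
    {w : TangentBundle 𝓘(ℝ, E) M} (h : ∀ᶠ v in 𝓝 w, dproj v (X v) = V v.1)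
    (hX : DifferentiableAt ℝ (chartRep w X) (extChartAt 𝓘(ℝ, E).tangent w w))
    (hV : DifferentiableAt ℝ (chartRep w.1 V) (extChartAt 𝓘(ℝ, E) w.1 w.1)) (v : E × E) :
    (fderiv ℝ (chartRep w X) (extChartAt 𝓘(ℝ, E).tangent w w) v).1 =
      fderiv ℝ (chartRep w.1 V) (extChartAt 𝓘(ℝ, E) w.1 w.1) v.1 := by
  have h1 : HasFDerivAt (fun z : E × E => chartRep w.1 V z.1)
      ((fderiv ℝ (chartRep w.1 V) (extChartAt 𝓘(ℝ, E) w.1 w.1)).comp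
        (ContinuousLinearMap.fst ℝ E E)) (extChartAt 𝓘(ℝ, E).tangent w w) :=
    HasFDerivAt.comp (f := Prod.fst) (extChartAt 𝓘(ℝ, E).tangent w w) hV.hasFDerivAt hasFDerivAt_fst
  have h2 := h1.congr_of_eventuallyEq (chartRep_fst_of_dproj_eq h)
  exact DFunLike.congr_fun (hX.hasFDerivAt.fst.unique h2) v

end SmoothFields

/-! ### The spray, its canonical connection and horizontal lifts -/

section Spray

variable {E : Type*} [NormedAddCommGroup E] [NormedSpace ℝ E]
  {M : Type*} [TopologicalSpace M] [ChartedSpace E M] [IsManifold 𝓘(ℝ, E) ∞ M]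
  {S : TMField E M}

theorem IsSpray.dproj_eq (hS : IsSpray S) {w : TangentBundle 𝓘(ℝ, E) M} (hw : w ∈ slit E M) :
    dproj w (S w) = w.2 :=
  vlift_injective w (hS.secondOrder w hw)

theorem IsSpray.chartRep_fst (hS : IsSpray S) {w₀ : TangentBundle 𝓘(ℝ, E) M}
    (hw₀ : w₀ ∈ slit E M) :
    (fun z => (chartRep w₀ S z).1) =ᶠ[𝓝 (extChartAt 𝓘(ℝ, E).tangent w₀ w₀)] Prod.snd := by
  have h' := (continuousAt_extChartAt_symm (I := 𝓘(ℝ, E).tangent) w₀).eventually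
    (by rw [extChartAt_to_inv]; exact isOpen_slit.mem_nhds hw₀)
  filter_upwards [h', extChartAt_target_mem_nhds (I := 𝓘(ℝ, E).tangent) w₀] with z hz hzt
  have hw := mem_extChartAt_tangentBundle_source.1
    ((extChartAt 𝓘(ℝ, E).tangent w₀).map_target hzt)
  rw [chartRep, chartD_fst hw, hS.dproj_eq hz, chartD_symm_snd hzt]

theorem IsSpray.differentiableAt_chartRep (hS : IsSpray S) {w : TangentBundle 𝓘(ℝ, E) M}
    (hw : w ∈ slit E M) :
    DifferentiableAt ℝ (chartRep w S) (extChartAt 𝓘(ℝ, E).tangent w w) :=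
  ((TMField.smoothOn_iff isOpen_slit).1 hS.smooth w hw).differentiableAt (by simp)

theorem IsSpray.fderiv_chartRep_fst (hS : IsSpray S) {w : TangentBundle 𝓘(ℝ, E) M}
    (hw : w ∈ slit E M) (v : E × E) :
    (fderiv ℝ (chartRep w S) (extChartAt 𝓘(ℝ, E).tangent w w) v).1 = v.2 :=
  DFunLike.congr_fun ((hS.differentiableAt_chartRep hw).hasFDerivAt.fst.unique
    (hasFDerivAt_snd.congr_of_eventuallyEq (hS.chartRep_fst hw))) v

/-- The fibre derivative of the second component of a semispray, in the preferred chart at `w`. -/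
def fibreDeriv (S : TMField E M) (w : TangentBundle 𝓘(ℝ, E) M) (a : E) : E :=
  (fderiv ℝ (chartRep w S) (extChartAt 𝓘(ℝ, E).tangent w w) ((0 : E), a)).2

/-- The derivatives of `X` along `S` occur in both `[S, JX]` and `J[S, X]` and cancel. Only the
value of `X` at `w` survives, which is the tensoriality of `[S, J]`. -/
theorem chartD_neg_lieDerivAlmostTangent (hS : IsSpray S) {w : TangentBundle 𝓘(ℝ, E) M}
    (hw : w ∈ slit E M) {X : TMField E M}
    (hX : DifferentiableAt ℝ (chartRep w X) (extChartAt 𝓘(ℝ, E).tangent w w)) :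
    chartD w w (-lieDerivAlmostTangent S X w) =
      ((chartD w w (X w)).1,
        fibreDeriv S w (chartD w w (X w)).1 - (chartD w w (X w)).2) := by
  have h := hS.fderiv_chartRep_fst hw ((0 : E), (chartD w w (X w)).1)
  rw [map_neg, lieDerivAlmostTangent, map_sub, chartD_almostTangent, chartD_bracket,
    chartD_bracket, fderiv_chartRep_almostTangentField hX, almostTangentField,
    chartD_almostTangent, Prod.fst_sub, hS.fderiv_chartRep_fst hw]
  refine Prod.ext ?_ ?_
  · simp only [Prod.fst_neg, Prod.fst_sub, h]
    abel
  · simp only [Prod.snd_neg, Prod.snd_sub, fibreDeriv]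
    abel

theorem chartD_canonicalConnection (hS : IsSpray S) {w : TangentBundle 𝓘(ℝ, E) M}
    (hw : w ∈ slit E M) (X : TangentSpace 𝓘(ℝ, E).tangent w) :
    chartD w w (canonicalConnection S w X) =
      ((chartD w w X).1, fibreDeriv S w (chartD w w X).1 - (chartD w w X).2) := by
  have hX : ContDiffAt ℝ ∞ (chartRep w (FiberBundle.extend (E × E) X))
      (extChartAt 𝓘(ℝ, E).tangent w w) :=
    (contMDiffAt_iff_chartRep (mem_chart_source _ w) _).1
      (FiberBundle.contMDiffAt_extend 𝓘(ℝ, E).tangent (E × E) X)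
  have := chartD_neg_lieDerivAlmostTangent hS hw (hX.differentiableAt (by simp))
  rwa [FiberBundle.extend_apply_self] at this

theorem isHorizontal_iff (hS : IsSpray S) {w : TangentBundle 𝓘(ℝ, E) M}
    (hw : w ∈ slit E M) (X : TangentSpace 𝓘(ℝ, E).tangent w) :
    IsHorizontal S w X ↔
      (chartD w w X).2 = (1 / 2 : ℝ) • fibreDeriv S w (chartD w w X).1 := by
  rw [IsHorizontal, ← (chartD_self_injective w).eq_iff, chartD_canonicalConnection hS hw,
    Prod.ext_iff]
  generalize (chartD w w X) = Y
  constructor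
  · rintro ⟨-, h⟩
    rw [sub_eq_iff_eq_add] at h
    rw [h, ← two_smul ℝ, smul_smul]
    norm_num
  · intro h
    refine ⟨rfl, ?_⟩
    simp only
    rw [h]
    module

theorem hlift_spec (hS : IsSpray S) {w : TangentBundle 𝓘(ℝ, E) M}
    (hw : w ∈ slit E M) (u : TangentSpace 𝓘(ℝ, E) w.1) :
    IsHorizontal S w (hlift S w u) ∧ dproj w (hlift S w u) = u := by
  obtain ⟨X, hX⟩ := (chartD_bijective (I := 𝓘(ℝ, E).tangent) (mem_extChartAt_source w)).surjective
    (chartD w.1 w.1 u, (1 / 2 : ℝ) • fibreDeriv S w (chartD w.1 w.1 u))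
  refine Classical.epsilon_spec (p := fun X => IsHorizontal S w X ∧ dproj w X = u)
    ⟨X, (isHorizontal_iff hS hw X).2 (by rw [hX]), ?_⟩
  exact chartD_self_injective w.1 (by rw [chartD_dproj, hX])

theorem chartD_hlift (hS : IsSpray S) {w : TangentBundle 𝓘(ℝ, E) M}
    (hw : w ∈ slit E M) (u : TangentSpace 𝓘(ℝ, E) w.1) :
    chartD w w (hlift S w u) =
      (chartD w.1 w.1 u, (1 / 2 : ℝ) • fibreDeriv S w (chartD w.1 w.1 u)) := by
  obtain ⟨h1, h2⟩ := hlift_spec hS hw u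
  have h3 := (isHorizontal_iff hS hw _).1 h1
  have h4 := chartD_dproj w (hlift S w u)
  rw [h2] at h4
  rw [← h4] at h3
  exact Prod.ext h4.symm h3

/-- Euler's relation: the second component of `[C, S] = S` is `∂_y s · y - s = s`. -/
theorem fibreDeriv_self (hS : IsSpray S) {w : TangentBundle 𝓘(ℝ, E) M} (hw : w ∈ slit E M) :
    fibreDeriv S w (chartD w.1 w.1 w.2) = (2 : ℝ) • (chartD w w (S w)).2 := by
  have h := congrArg (chartD w w) (hS.homogeneous w hw)
  rw [chartD_bracket, fderiv_chartRep_canonicalField, canonicalField, chartD_self_vlift,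
    sub_eq_iff_eq_add] at h
  rw [two_smul]
  exact congrArg Prod.snd h

theorem IsSpray.eq_hlift (hS : IsSpray S) {w : TangentBundle 𝓘(ℝ, E) M} (hw : w ∈ slit E M) :
    S w = hlift S w w.2 := by
  refine chartD_self_injective w ?_
  rw [chartD_hlift hS hw, fibreDeriv_self hS hw, smul_smul]
  refine Prod.ext ?_ ?_
  · rw [← chartD_dproj, hS.dproj_eq hw]
  · norm_num

theorem horizontalPart_eq (hS : IsSpray S) {w : TangentBundle 𝓘(ℝ, E) M} (hw : w ∈ slit E M)
    (X : TMField E M) : horizontalPart S X w = hlift S w (dproj w (X w)) := by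
  refine chartD_self_injective w ?_
  rw [horizontalPart, map_smul, map_add, chartD_canonicalConnection hS hw, chartD_hlift hS hw,
    chartD_dproj]
  generalize (chartD w w (X w)) = Y
  refine Prod.ext ?_ ?_
  · simp only [Prod.smul_fst, Prod.fst_add]
    module
  · simp only [Prod.smul_snd, Prod.snd_add]
    module

/-- The definition of `canonicalConnection` picks a new extension at every point, which hides
smoothness. Tensoriality lets `X` itself serve as the extension everywhere, leaving brackets of
smooth fields. -/
theorem smoothOn_horizontalPart [CompleteSpace E] (hS : IsSpray S) {X : TMField E M}
    (hX : X.SmoothOn (slit E M)) : (horizontalPart S X).SmoothOn (slit E M) := by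
  have hb := smoothOn_bracket isOpen_slit hS.smooth hX
  have hbJ := smoothOn_bracket isOpen_slit hS.smooth (smoothOn_almostTangentField isOpen_slit hX)
  have h := TMField.SmoothOn.smul (f := fun _ => (1 / 2 : ℝ)) contMDiffOn_const
    (hX.sub (hbJ.sub (smoothOn_almostTangentField isOpen_slit hb)))
  refine h.congr fun w hw => ?_
  have h1 := chartD_neg_lieDerivAlmostTangent hS hw
    (((TMField.smoothOn_iff isOpen_slit).1 hX w hw).differentiableAt (by simp))
  have h2 : canonicalConnection S w (X w) = -lieDerivAlmostTangent S X w :=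
    chartD_self_injective w ((chartD_canonicalConnection hS hw (X w)).trans h1.symm)
  rw [horizontalPart, h2, ← sub_eq_add_neg]
  rfl

/-- The horizontal lift of a vector field on `M`, as a vector field on `TM \ 0`. -/
def fieldHlift (S : TMField E M) (V : MField E M) : TMField E M :=
  horizontalPart S (bracket (fieldVlift V) S)

/-- This is why `fieldHlift` starts from `[V^v, S]`: it is a smooth field projecting to `V`, built
without any choice, and its horizontal part is then the horizontal lift, already in the form `ℋX`
that (T2) requires. -/
theorem dproj_bracket_fieldVlift (hS : IsSpray S) {w : TangentBundle 𝓘(ℝ, E) M}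
    (hw : w ∈ slit E M) {V : MField E M}
    (hV : DifferentiableAt ℝ (chartRep w.1 V) (extChartAt 𝓘(ℝ, E) w.1 w.1)) :
    dproj w (bracket (fieldVlift V) S w) = V w.1 := by
  refine chartD_self_injective w.1 ?_
  rw [chartD_dproj, chartD_bracket, fderiv_chartRep_fieldVlift hV, Prod.fst_sub,
    fieldVlift, chartD_self_vlift, hS.fderiv_chartRep_fst hw]
  exact sub_zero _

theorem fieldHlift_eq (hS : IsSpray S) {w : TangentBundle 𝓘(ℝ, E) M}
    (hw : w ∈ slit E M) {V : MField E M} (hV : SmoothFieldOn V Set.univ) :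
    fieldHlift S V w = hlift S w (V w.1) := by
  rw [fieldHlift, horizontalPart_eq hS hw, dproj_bracket_fieldVlift hS hw
    ((hV.contDiffAt_chartRep isOpen_univ (Set.mem_univ _)).differentiableAt (by simp))]

theorem smoothOn_bracket_fieldVlift [CompleteSpace E] (hS : IsSpray S) {V : MField E M}
    (hV : SmoothFieldOn V Set.univ) : (bracket (fieldVlift V) S).SmoothOn (slit E M) :=
  smoothOn_bracket isOpen_slit
    (smoothOn_fieldVlift isOpen_univ hV isOpen_slit fun _ _ => Set.mem_univ _) hS.smooth

theorem smoothOn_fieldHlift [CompleteSpace E] (hS : IsSpray S) {V : MField E M}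
    (hV : SmoothFieldOn V Set.univ) : (fieldHlift S V).SmoothOn (slit E M) :=
  smoothOn_horizontalPart hS (smoothOn_bracket_fieldVlift hS hV)

theorem almostTangentField_fieldHlift (hS : IsSpray S) {w : TangentBundle 𝓘(ℝ, E) M}
    (hw : w ∈ slit E M) {V : MField E M} (hV : SmoothFieldOn V Set.univ) :
    almostTangentField (fieldHlift S V) w = fieldVlift V w := by
  rw [almostTangentField, almostTangent, fieldHlift_eq hS hw hV, (hlift_spec hS hw _).2, fieldVlift]

end Spray

/-! ### Locality of a vertical connection and derivatives at zeros -/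

section VerticalConnections

variable {E : Type*} [NormedAddCommGroup E] [NormedSpace ℝ E]
  {M : Type*} [TopologicalSpace M] [ChartedSpace E M] [IsManifold 𝓘(ℝ, E) ∞ M]

theorem isVertical_vlift (w : TangentBundle 𝓘(ℝ, E) M) (u : TangentSpace 𝓘(ℝ, E) w.1) :
    IsVertical w (vlift w u) := by
  refine chartD_self_injective w.1 ?_
  rw [chartD_dproj, chartD_self_vlift, map_zero]

theorem IsVertical.exists_vlift {w : TangentBundle 𝓘(ℝ, E) M}
    {X : TangentSpace 𝓘(ℝ, E).tangent w} (hX : IsVertical w X) : ∃ u, vlift w u = X := by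
  obtain ⟨u, hu⟩ := (chartD_bijective (I := 𝓘(ℝ, E)) (mem_extChartAt_source w.1)).surjective
    (chartD w w X).2
  refine ⟨u, chartD_self_injective w ?_⟩
  rw [chartD_self_vlift, hu]
  refine Prod.ext ?_ rfl
  rw [← chartD_dproj, show dproj w X = 0 from hX, map_zero]

theorem IsVertical.vlift_vliftInv {w : TangentBundle 𝓘(ℝ, E) M}
    {X : TangentSpace 𝓘(ℝ, E).tangent w} (hX : IsVertical w X) : vlift w (vliftInv w X) = X := by
  obtain ⟨u, rfl⟩ := hX.exists_vlift
  rw [vliftInv_vlift]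

theorem IsVertical.smul {w : TangentBundle 𝓘(ℝ, E) M}
    {X : TangentSpace 𝓘(ℝ, E).tangent w} (hX : IsVertical w X) (a : ℝ) : IsVertical w (a • X) := by
  rw [IsVertical, map_smul, show dproj w X = 0 from hX, smul_zero]

theorem IsVertical.add {w : TangentBundle 𝓘(ℝ, E) M}
    {X Y : TangentSpace 𝓘(ℝ, E).tangent w} (hX : IsVertical w X) (hY : IsVertical w Y) :
    IsVertical w (X + Y) := by
  rw [IsVertical, map_add, show dproj w X = 0 from hX, show dproj w Y = 0 from hY, add_zero]

namespace VerticalConnection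

variable (D : VerticalConnection E M) {U : Set (TangentBundle 𝓘(ℝ, E) M)}

theorem toFun_congr (hU : IsOpen U) (hUs : U ⊆ slit E M) {Y Z : TMField E M}
    (hY : Y.SmoothOn U) (hYv : ∀ w ∈ U, IsVertical w (Y w)) (h : ∀ w ∈ U, Y w = Z w)
    {w : TangentBundle 𝓘(ℝ, E) M} (hw : w ∈ U) (X : TangentSpace 𝓘(ℝ, E).tangent w) :
    D.toFun Y w X = D.toFun Z w X := by
  classical
  -- No bump function is needed: the Leibniz rule asks for smoothness on `U` only, where the
  -- indicator is constant, and multiplying by it makes the two fields equal everywhere.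
  let f : TangentBundle 𝓘(ℝ, E) M → ℝ := U.indicator fun _ => 1
  have hf1 : ∀ v ∈ U, f v = 1 := fun v hv => Set.indicator_of_mem hv _
  have hf : ContMDiffOn 𝓘(ℝ, E).tangent 𝓘(ℝ, ℝ) ∞ f U :=
    (contMDiffOn_const (c := (1 : ℝ))).congr hf1
  have hfe : f =ᶠ[𝓝 w] fun _ => (1 : ℝ) := Filter.eventuallyEq_of_mem (hU.mem_nhds hw) hf1
  have hdf : mvfderiv 𝓘(ℝ, E).tangent f w = 0 := by
    rw [mvfderiv, hfe.mfderiv_eq, mfderiv_const]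
    rfl
  have key : ∀ T : TMField E M, T.SmoothOn U → (∀ v ∈ U, IsVertical v (T v)) →
      D.toFun (fun v => f v • T v) w X = D.toFun T w X := fun T hT hTv => by
    rw [D.leibniz hU hUs hf hT hTv w hw X, hdf, hf1 w hw]
    simp
  have hYZ : (fun v => f v • Y v) = fun v => f v • Z v := by
    funext v
    by_cases hv : v ∈ U
    · rw [h v hv]
    · simp [f, Set.indicator_of_notMem hv]
  rw [← key Y hY hYv, hYZ, key Z (hY.congr fun v hv => (h v hv).symm)
    fun v hv => h v hv ▸ hYv v hv]

theorem toFun_sum_smul (hU : IsOpen U) (hUs : U ⊆ slit E M) {ι : Type*} (s : Finset ι)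
    {f : ι → TangentBundle 𝓘(ℝ, E) M → ℝ} {Y : ι → TMField E M}
    (hf : ∀ i, ContMDiffOn 𝓘(ℝ, E).tangent 𝓘(ℝ, ℝ) ∞ (f i) U)
    (hY : ∀ i, (Y i).SmoothOn U) (hYv : ∀ i, ∀ w ∈ U, IsVertical w (Y i w))
    {w : TangentBundle 𝓘(ℝ, E) M} (hw : w ∈ U) (X : TangentSpace 𝓘(ℝ, E).tangent w) :
    D.toFun (fun v => ∑ i ∈ s, f i v • Y i v) w X =
      ∑ i ∈ s, (f i w • D.toFun (Y i) w X + mvfderiv 𝓘(ℝ, E).tangent (f i) w X • Y i w) := by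
  classical
  have hfY : ∀ i, TMField.SmoothOn (fun v => f i v • Y i v) U := fun i => (hY i).smul (hf i)
  have hfYv : ∀ i, ∀ v ∈ U, IsVertical v (f i v • Y i v) := fun i v hv => (hYv i v hv).smul _
  have hsv : ∀ s : Finset ι, ∀ v ∈ U, IsVertical v (∑ i ∈ s, f i v • Y i v) := fun s v hv => by
    rw [IsVertical, map_sum]
    exact Finset.sum_eq_zero fun i _ => hfYv i v hv
  induction s using Finset.induction_on with
  | empty =>
    have h0 := TMField.SmoothOn.sum (s := (∅ : Finset ι)) (X := fun i v => f i v • Y i v) (U := U)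
      fun i _ => hfY i
    -- The derivative of the zero field vanishes, by additivity applied to `0 + 0 = 0`.
    have h := D.add hU hUs h0 h0 (hsv ∅) (hsv ∅) w hw X
    simp only [Finset.sum_empty, add_zero] at h ⊢
    exact left_eq_add.1 h
  | insert i s hi ih =>
    simp only [Finset.sum_insert hi]
    rw [D.add hU hUs (hfY i) (TMField.SmoothOn.sum fun i _ => hfY i) (hfYv i) (hsv s) w hw X, ih,
      D.leibniz hU hUs (hf i) (hY i) (hYv i) w hw X]

/-- At a zero of a vertical field, its covariant derivative is its intrinsic derivative. -/
theorem chartD_toFun_of_eq_zero [FiniteDimensional ℝ E] (hU : IsOpen U) (hUs : U ⊆ slit E M)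
    {Z : TMField E M} (hZ : Z.SmoothOn U) (hZv : ∀ w ∈ U, IsVertical w (Z w))
    {w : TangentBundle 𝓘(ℝ, E) M} (hw : w ∈ U) (hZw : Z w = 0)
    (X : TangentSpace 𝓘(ℝ, E).tangent w) :
    chartD w w (D.toFun Z w X) =
      ((0 : E),
        (fderiv ℝ (chartRep w Z) (extChartAt 𝓘(ℝ, E).tangent w w) (chartD w w X)).2) := by
  let b := Module.finBasis ℝ E
  let U' := U ∩ (extChartAt 𝓘(ℝ, E).tangent w).source
  have hU' : IsOpen U' := hU.inter (isOpen_extChartAt_source w)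
  have hU's : U' ⊆ slit E M := fun v hv => hUs hv.1
  have hwU' : w ∈ U' := ⟨hw, mem_extChartAt_source w⟩
  have hU'c : ∀ v ∈ U', v.1 ∈ (chartAt E w.1).source := fun v hv =>
    mem_extChartAt_tangentBundle_source.1 hv.2
  -- The coordinate fields of the chart at `w.1`; their vertical lifts form a local frame of the
  -- vertical bundle. The coefficients `f i` of `Z` in it vanish at `w`, so Leibniz leaves only the
  -- terms `df_i(X)` and the values of the frame at `w`.
  let e : Fin (Module.finrank ℝ E) → MField E M := fun i x =>
    (trivializationAt E (TangentSpace 𝓘(ℝ, E)) w.1).symm x (b i)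
  have hechart : ∀ i, ∀ x ∈ (chartAt E w.1).source, chartD w.1 x (e i x) = b i := by
    intro i x hx
    rw [← trivializationAt_snd_eq_chartD hx]
    exact congrArg Prod.snd
      ((trivializationAt E (TangentSpace 𝓘(ℝ, E)) w.1).apply_mk_symm hx (b i))
  have he : ∀ i, SmoothFieldOn (e i) (chartAt E w.1).source := by
    intro i x hx
    refine ContMDiffAt.contMDiffWithinAt ((contMDiffAt_iff_chartRep hx (e i)).2 ?_)
    refine (contDiffAt_const (c := b i)).congr_of_eventuallyEq ?_
    have hx' : x ∈ (extChartAt 𝓘(ℝ, E) w.1).source := by rwa [extChartAt_source]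
    filter_upwards [extChartAt_target_mem_nhds' (I := 𝓘(ℝ, E))
      ((extChartAt 𝓘(ℝ, E) w.1).map_source hx')] with z hz
    refine hechart i _ ?_
    rw [← extChartAt_source 𝓘(ℝ, E)]
    exact (extChartAt 𝓘(ℝ, E) w.1).map_target hz
  let g : Fin (Module.finrank ℝ E) → E × E → ℝ := fun i z => b.coord i (chartRep w Z z).2
  let f : Fin (Module.finrank ℝ E) → TangentBundle 𝓘(ℝ, E) M → ℝ := fun i v =>
    g i (extChartAt 𝓘(ℝ, E).tangent w v)
  have hrep : ∀ v ∈ U', ContDiffAt ℝ ∞ (chartRep w Z) (extChartAt 𝓘(ℝ, E).tangent w v) :=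
    fun v hv => (contMDiffAt_iff_chartRep (by simpa only [extChartAt_source] using hv.2) Z).1
      ((hZ v hv.1).contMDiffAt (hU.mem_nhds hv.1))
  have hg : ∀ i, ∀ v ∈ U', ContDiffAt ℝ ∞ (g i) (extChartAt 𝓘(ℝ, E).tangent w v) :=
    fun i v hv => (LinearMap.toContinuousLinearMap (b.coord i)).contDiff.contDiffAt.comp _
      (hrep v hv).snd
  have hf : ∀ i, ContMDiffOn 𝓘(ℝ, E).tangent 𝓘(ℝ, ℝ) ∞ (f i) U' := fun i v hv =>
    ((hg i v hv).contMDiffAt.comp v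
      (contMDiffAt_extChartAt' (by simpa only [extChartAt_source] using hv.2))).contMDiffWithinAt
  have hdecomp : ∀ v ∈ U', Z v = ∑ i, f i v • fieldVlift (e i) v := by
    intro v hv
    refine (chartD_bijective hv.2).injective ?_
    rw [map_sum]
    have h1 : ∀ i, chartD w v (f i v • fieldVlift (e i) v) = ((0 : E), f i v • b i) := fun i => by
      rw [map_smul, fieldVlift, chartD_vlift (hU'c v hv), hechart i _ (hU'c v hv), Prod.smul_mk,
        smul_zero]
    simp only [h1]
    refine Prod.ext ?_ ?_
    · rw [chartD_fst (hU'c v hv), show dproj v (Z v) = 0 from hZv v hv.1, map_zero, Prod.fst_sum]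
      simp
    · rw [Prod.snd_sum]
      simp only [f, g, chartRep_extChartAt Z hv.2]
      exact (b.sum_repr _).symm
  have hfw : ∀ i, f i w = 0 := fun i => by
    simp only [f, g, chartRep_extChartAt Z hwU'.2, hZw, map_zero, Prod.snd_zero]
  have hdf : ∀ i, mvfderiv 𝓘(ℝ, E).tangent (f i) w X = b.coord i
      (fderiv ℝ (chartRep w Z) (extChartAt 𝓘(ℝ, E).tangent w w) (chartD w w X)).2 := by
    intro i
    have h1 : HasFDerivAt (g i) _ (extChartAt 𝓘(ℝ, E).tangent w w) :=
      (LinearMap.toContinuousLinearMap (b.coord i)).hasFDerivAt.comp _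
        ((hrep w hwU').differentiableAt (by simp)).hasFDerivAt.snd
    have h2 := (hasMFDerivAt_iff_hasFDerivAt.2 h1).comp w
      (mdifferentiableAt_extChartAt (I := 𝓘(ℝ, E).tangent) (mem_chart_source _ w)).hasMFDerivAt
    exact DFunLike.congr_fun h2.mfderiv X
  have hev : ∀ i, (fieldVlift (e i)).SmoothOn U' := fun i =>
    smoothOn_fieldVlift (chartAt E w.1).open_source (he i) hU' hU'c
  rw [D.toFun_congr hU' hU's (hZ.mono Set.inter_subset_left) (fun v hv => hZv v hv.1) hdecomp hwU',
    D.toFun_sum_smul hU' hU's Finset.univ hf hev (fun i v _ => isVertical_vlift v _) hwU', map_sum]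
  have h1 : ∀ i, chartD w w (f i w • D.toFun (fieldVlift (e i)) w X +
      mvfderiv 𝓘(ℝ, E).tangent (f i) w X • fieldVlift (e i) w) = ((0 : E), b.coord i
        (fderiv ℝ (chartRep w Z) (extChartAt 𝓘(ℝ, E).tangent w w) (chartD w w X)).2 • b i) := by
    intro i
    rw [hfw, zero_smul, zero_add, hdf, map_smul, fieldVlift, chartD_self_vlift,
      hechart i _ (mem_chart_source E w.1), Prod.smul_mk, smul_zero]
  simp only [h1]
  refine Prod.ext ?_ ?_
  · rw [Prod.fst_sum]
    simp
  · rw [Prod.snd_sum]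
    exact b.sum_repr _

end VerticalConnection

end VerticalConnections

/-! ### The induced affine derivatives and their torsion -/

section AffineConnections

variable {E : Type*} [NormedAddCommGroup E] [NormedSpace ℝ E]
  {M : Type*} [TopologicalSpace M] [ChartedSpace E M] [IsManifold 𝓘(ℝ, E) ∞ M]

/-- A smooth local vector field coincides near each point with a smooth global one. -/
theorem SmoothFieldOn.exists_global [FiniteDimensional ℝ E] [T2Space M] {V : MField E M}
    {O : Set M} (hO : IsOpen O) (hV : SmoothFieldOn V O) {x : M} (hx : x ∈ O) :
    ∃ V' : MField E M, SmoothFieldOn V' Set.univ ∧ ∀ᶠ y in 𝓝 x, V' y = V y := by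
  obtain ⟨f, -, hf⟩ := (SmoothBumpFunction.nhds_basis_tsupport (I := 𝓘(ℝ, E)) x).mem_iff.1
    (hO.mem_nhds hx)
  refine ⟨fun y => f y • V y, ContMDiff.contMDiffOn ?_, ?_⟩
  · exact ContMDiffOn.smul_section_of_tsupport (f.contMDiff.contMDiffOn) hO hf hV
  · filter_upwards [f.eventuallyEq_one] with y hy
    rw [hy, Pi.one_apply, one_smul]

theorem SmoothFieldOn.differentiableAt_chartRep {V : MField E M} {O : Set M} (hO : IsOpen O)
    (hV : SmoothFieldOn V O) {x : M} (hx : x ∈ O) :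
    DifferentiableAt ℝ (chartRep x V) (extChartAt 𝓘(ℝ, E) x x) :=
  (hV.contDiffAt_chartRep hO hx).differentiableAt (by simp)

theorem isOpen_slit_inter_proj {O : Set M} (hO : IsOpen O) :
    IsOpen (slit E M ∩ {w | w.1 ∈ O}) :=
  isOpen_slit.inter (hO.preimage (FiberBundle.continuous_proj E (TangentSpace 𝓘(ℝ, E))))

namespace VerticalConnection

variable {S : TMField E M} (D : VerticalConnection E M) {O : Set M}
  {w : TangentBundle 𝓘(ℝ, E) M}

theorem vlift_affine (hO : IsOpen O) (hw : w ∈ slit E M) (hwO : w.1 ∈ O) {V : MField E M}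
    (hV : SmoothFieldOn V O) (u : TangentSpace 𝓘(ℝ, E) w.1) :
    vlift w (D.affine S w u V) = D.toFun (fieldVlift V) w (hlift S w u) :=
  (D.vertical (isOpen_slit_inter_proj hO) Set.inter_subset_left
    (smoothOn_fieldVlift hO hV (isOpen_slit_inter_proj hO) fun _ h => h.2)
    (fun v _ => isVertical_vlift v _) w ⟨hw, hwO⟩ _).vlift_vliftInv

/-- Passes from the global extension `V'`, to which the torsion conditions apply, back to the local
field `V`. -/
theorem toFun_almostTangentField_fieldHlift (hS : IsSpray S) (hO : IsOpen O)
    (hw : w ∈ slit E M) (hwO : w.1 ∈ O) {V V' : MField E M} (hV : SmoothFieldOn V O)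
    (hV' : SmoothFieldOn V' Set.univ) (hVV' : ∀ᶠ y in 𝓝 w.1, V' y = V y)
    (X : TangentSpace 𝓘(ℝ, E).tangent w) :
    D.toFun (almostTangentField (fieldHlift S V')) w X = D.toFun (fieldVlift V) w X := by
  obtain ⟨N, hN, hNo, hwN⟩ := eventually_nhds_iff.1 hVV'
  have hON := isOpen_slit_inter_proj (E := E) (hO.inter hNo)
  refine (D.toFun_congr hON Set.inter_subset_left (smoothOn_fieldVlift hO hV hON fun _ h => h.2.1)
    (fun v _ => isVertical_vlift v _) (fun v hv => ?_) ⟨hw, hwO, hwN⟩ X).symm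
  rw [almostTangentField_fieldHlift hS hv.1 hV', fieldVlift, fieldVlift, hN v.1 hv.2.2]

theorem chartD_affine_of_T1 [FiniteDimensional ℝ E] [T2Space M] (hS : IsSpray S)
    (hD : D.IsLift S) (hT : D.T1 S) (hO : IsOpen O) (hw : w ∈ slit E M) (hwO : w.1 ∈ O)
    {V : MField E M} (hV : SmoothFieldOn V O) :
    chartD w.1 w.1 (D.affine S w w.2 V) =
      fderiv ℝ (chartRep w.1 V) (extChartAt 𝓘(ℝ, E) w.1 w.1) (chartD w.1 w.1 w.2) -
        (1 / 2 : ℝ) • fibreDeriv S w (chartD w.1 w.1 (V w.1)) := by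
  obtain ⟨V', hV', hVV'⟩ := hV.exists_global hO hwO
  have hsm := smoothOn_fieldHlift hS hV'
  have h := hT (fieldHlift S V') hsm w hw
  -- On `TM \ 0` the field `J(S)` is `C`, and `∇C` kills horizontal vectors.
  have hJS : D.toFun (almostTangentField S) w (fieldHlift S V' w) = 0 := by
    rw [← D.toFun_congr (Z := almostTangentField S) isOpen_slit subset_rfl (smoothOn_canonicalField isOpen_slit)
      (fun v _ => isVertical_vlift v _) (fun v hv => (hS.secondOrder v hv).symm) hw,
      hD.ker_eq w hw, fieldHlift_eq hS hw hV']
    exact (hlift_spec hS hw _).1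
  have hd : ∀ᶠ v in 𝓝 w, dproj v (fieldHlift S V' v) = V' v.1 := by
    filter_upwards [isOpen_slit.mem_nhds hw] with v hv
    rw [fieldHlift_eq hS hv hV', (hlift_spec hS hv _).2]
  rw [torsion, hJS, sub_zero, D.toFun_almostTangentField_fieldHlift hS hO hw hwO hV hV' hVV',
    hS.eq_hlift hw, ← D.vlift_affine hO hw hwO hV] at h
  have h1 := congrArg (chartD w w) h
  rw [map_sub, chartD_self_vlift, chartD_almostTangent, chartD_bracket, map_zero, Prod.fst_sub,
    hS.fderiv_chartRep_fst hw, fderiv_chartRep_fst_of_dproj_eq hd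
      (((TMField.smoothOn_iff isOpen_slit).1 hsm w hw).differentiableAt (by simp))
      (hV'.differentiableAt_chartRep isOpen_univ (Set.mem_univ _)),
    fieldHlift_eq hS hw hV', chartD_hlift hS hw, ← chartD_dproj, hS.dproj_eq hw,
    (chartRep_congr hVV').fderiv_eq, hVV'.self_of_nhds] at h1
  exact sub_eq_zero.1 (congrArg Prod.snd h1)

/-- The hypothesis `hWw` makes `W^v - C` vanish at `w`, so its covariant derivative is `dW(u)` minus
the fibre component of the horizontal lift of `u`. No torsion condition enters. -/
theorem chartD_affine_self [FiniteDimensional ℝ E] (hS : IsSpray S)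
    (hD : D.IsLift S) (hO : IsOpen O) {W : MField E M} (hW : SmoothFieldOn W O)
    (hw : w ∈ slit E M) (hwO : w.1 ∈ O) (hWw : W w.1 = w.2) (u : TangentSpace 𝓘(ℝ, E) w.1) :
    chartD w.1 w.1 (D.affine S w u W) =
      fderiv ℝ (chartRep w.1 W) (extChartAt 𝓘(ℝ, E) w.1 w.1) (chartD w.1 w.1 u) -
        (1 / 2 : ℝ) • fibreDeriv S w (chartD w.1 w.1 u) := by
  have hU := isOpen_slit_inter_proj (E := E) hO
  set U := slit E M ∩ {w : TangentBundle 𝓘(ℝ, E) M | w.1 ∈ O}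
  have hUs : U ⊆ slit E M := Set.inter_subset_left
  have hwU : w ∈ U := ⟨hw, hwO⟩
  have hC := (smoothOn_canonicalField isOpen_slit).mono hUs
  have hWs := smoothOn_fieldVlift hO hW hU fun _ h => h.2
  -- The difference is written as a sum with a constant multiple, so that `D.add` and `D.leibniz`
  -- apply.
  let Z : TMField E M := fun v => fieldVlift W v + (-1 : ℝ) • canonicalField v
  have hm : ContMDiffOn 𝓘(ℝ, E).tangent 𝓘(ℝ, ℝ) ∞
    (fun _ : TangentBundle 𝓘(ℝ, E) M => (-1 : ℝ)) U := contMDiffOn_const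
  have hC' : TMField.SmoothOn (fun v => (-1 : ℝ) • (canonicalField v :
    TangentSpace 𝓘(ℝ, E).tangent v)) U := TMField.SmoothOn.smul hm hC
  have hCv : ∀ v ∈ U, IsVertical v ((-1 : ℝ) • (canonicalField v :
    TangentSpace 𝓘(ℝ, E).tangent v)) := fun v _ => (isVertical_vlift v _).smul _
  have hZ : Z.SmoothOn U := hWs.add hC'
  have hZv : ∀ v ∈ U, IsVertical v (Z v) := fun v hv => (isVertical_vlift v _).add (hCv v hv)
  have hZw : Z w = 0 := by
    simp only [Z, fieldVlift, canonicalField, hWw]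
    module
  -- Subtracting `C` costs nothing along a horizontal vector.
  have hcov : D.toFun Z w (hlift S w u) = D.toFun (fieldVlift W) w (hlift S w u) := by
    have h1 := D.leibniz hU hUs hm hC (fun v _ => isVertical_vlift v _) w hwU (hlift S w u)
    rw [(hD.ker_eq w hw _).2 (hlift_spec hS hw u).1, mvfderiv, mfderiv_const] at h1
    have h2 := D.add hU hUs hWs hC' (fun v _ => isVertical_vlift v _) hCv w hwU (hlift S w u)
    rw [h1] at h2
    refine h2.trans ?_
    simp
  have h := D.chartD_toFun_of_eq_zero hU hUs hZ hZv hwU hZw (hlift S w u)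
  have hrep : chartRep w Z = fun z => chartRep w (fieldVlift W) z - chartRep w canonicalField z := by
    funext z
    simp only [chartRep, Z, map_add, map_smul]
    module
  have hdW := ((TMField.smoothOn_iff hU).1 hWs w hwU).differentiableAt (by simp)
  have hdC := ((TMField.smoothOn_iff hU).1 hC w hwU).differentiableAt (by simp)
  rw [hcov, ← D.vlift_affine hO hw hwO hW, chartD_self_vlift, hrep, fderiv_fun_sub hdW hdC,
    sub_apply, fderiv_chartRep_canonicalField,
    fderiv_chartRep_fieldVlift (hW.differentiableAt_chartRep hO hwO), chartD_hlift hS hw] at h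
  exact congrArg Prod.snd h

theorem affine_sub_affine_of_T1 [FiniteDimensional ℝ E] [T2Space M] (hS : IsSpray S)
    (hD : D.IsLift S) (hT : D.T1 S) (hO : IsOpen O) (hw : w ∈ slit E M) (hwO : w.1 ∈ O)
    {V W : MField E M} (hV : SmoothFieldOn V O) (hW : SmoothFieldOn W O) (hWw : W w.1 = w.2) :
    D.affine S w w.2 V - D.affine S w (V w.1) W = VectorField.mlieBracket 𝓘(ℝ, E) W V w.1 := by
  refine chartD_self_injective w.1 ?_
  rw [map_sub, D.chartD_affine_of_T1 hS hD hT hO hw hwO hV,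
    D.chartD_affine_self hS hD hO hW hw hwO hWw, chartD_mlieBracket, hWw]
  abel

/-- The horizontal lifts are `π`-related to `U'` and `V'`, so the first component of their bracket
involves derivatives on `M` only. The map `J` moves it to the second component, where it is compared
with the vertical lifts. -/
theorem affine_sub_affine_of_T2 [FiniteDimensional ℝ E] [T2Space M] (hS : IsSpray S)
    (hT : D.T2 S) (hO : IsOpen O) (hw : w ∈ slit E M) (hwO : w.1 ∈ O)
    {U V : MField E M} (hU : SmoothFieldOn U O) (hV : SmoothFieldOn V O) :
    D.affine S w (U w.1) V - D.affine S w (V w.1) U =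
      VectorField.mlieBracket 𝓘(ℝ, E) U V w.1 := by
  obtain ⟨U', hU', hUU'⟩ := hU.exists_global hO hwO
  obtain ⟨V', hV', hVV'⟩ := hV.exists_global hO hwO
  have hd : ∀ T : MField E M, SmoothFieldOn T Set.univ →
      ∀ᶠ v in 𝓝 w, dproj v (fieldHlift S T v) = T v.1 := fun T hT => by
    filter_upwards [isOpen_slit.mem_nhds hw] with v hv
    rw [fieldHlift_eq hS hv hT, (hlift_spec hS hv _).2]
  have hdiff : ∀ T : MField E M, SmoothFieldOn T Set.univ →
      DifferentiableAt ℝ (chartRep w (fieldHlift S T)) (extChartAt 𝓘(ℝ, E).tangent w w) :=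
    fun T hT => ((TMField.smoothOn_iff isOpen_slit).1
      (smoothOn_fieldHlift hS hT) w hw).differentiableAt (by simp)
  have h := hT _ _ (smoothOn_bracket_fieldVlift hS hU') (smoothOn_bracket_fieldVlift hS hV') w hw
  -- The fields inserted in (T2) are `[U'^v, S]` and `[V'^v, S]`, whose horizontal parts are
  -- `fieldHlift` by definition.
  change D.torsion (fieldHlift S U') (fieldHlift S V') w = 0 at h
  rw [torsion, D.toFun_almostTangentField_fieldHlift hS hO hw hwO hV hV' hVV',
    D.toFun_almostTangentField_fieldHlift hS hO hw hwO hU hU' hUU',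
    fieldHlift_eq hS hw hU', fieldHlift_eq hS hw hV', hUU'.self_of_nhds, hVV'.self_of_nhds,
    ← D.vlift_affine hO hw hwO hV, ← D.vlift_affine hO hw hwO hU] at h
  have h1 := congrArg (chartD w w) h
  rw [map_sub, map_sub, chartD_self_vlift, chartD_self_vlift, chartD_almostTangent, chartD_bracket,
    map_zero, Prod.fst_sub,
    fderiv_chartRep_fst_of_dproj_eq (hd U' hU') (hdiff U' hU')
      (hU'.differentiableAt_chartRep isOpen_univ (Set.mem_univ _)),
    fderiv_chartRep_fst_of_dproj_eq (hd V' hV') (hdiff V' hV')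
      (hV'.differentiableAt_chartRep isOpen_univ (Set.mem_univ _)),
    fieldHlift_eq hS hw hU', fieldHlift_eq hS hw hV', chartD_hlift hS hw, chartD_hlift hS hw,
    (chartRep_congr hUU').fderiv_eq, (chartRep_congr hVV').fderiv_eq,
    hUU'.self_of_nhds, hVV'.self_of_nhds] at h1
  refine chartD_self_injective w.1 ?_
  rw [map_sub, chartD_mlieBracket]
  exact sub_eq_zero.1 (congrArg Prod.snd h1)

end VerticalConnection

end AffineConnections

end SprayGeometry

end

theorem mainTheorem9
    {E : Type*} [NormedAddCommGroup E] [NormedSpace ℝ E] [FiniteDimensional ℝ E]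
    {M : Type*} [TopologicalSpace M] [T2Space M] [ChartedSpace E M] [IsManifold 𝓘(ℝ, E) ∞ M]
    (S : SprayGeometry.TMField E M) (hS : SprayGeometry.IsSpray S)
    (D : SprayGeometry.VerticalConnection E M) (hD : D.IsLift S)
    (O : Set M) (hO : IsOpen O)
    (W : SprayGeometry.MField E M) (hW : SprayGeometry.SmoothFieldOn W O)
    (hW0 : ∀ x ∈ O, W x ≠ 0) :
    (D.T1 S → ∀ V : SprayGeometry.MField E M, SprayGeometry.SmoothFieldOn V O →
      ∀ x ∈ O, D.affineField S W W V x - D.affineField S W V W x =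
        VectorField.mlieBracket 𝓘(ℝ, E) W V x) ∧
    (D.T2 S → ∀ U V : SprayGeometry.MField E M,
      SprayGeometry.SmoothFieldOn U O → SprayGeometry.SmoothFieldOn V O →
      ∀ x ∈ O, D.affineField S W U V x - D.affineField S W V U x =
        VectorField.mlieBracket 𝓘(ℝ, E) U V x) := by
  refine ⟨fun hT V hV x hx => ?_, fun hT U V hU hV x hx => ?_⟩
  -- Both identities are pointwise: they are the fibrewise statements at `w = W(x)`, which lies in
  -- `TM \ 0` because `W` has no zero.
  · exact D.affine_sub_affine_of_T1 hS hD hT hO (w := ⟨x, W x⟩) (hW0 x hx) hx hV hW rfl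
  · exact D.affine_sub_affine_of_T2 hS hT hO (w := ⟨x, W x⟩) (hW0 x hx) hx hU hV
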